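/- For $n, r \in \mathbb{N}$ let $W(n,r)$ denote the $n$-dimensional Wishart distribution with $r$ degrees of freedom, i.e. the distribution of $GG^T$ where $G \in \mathbb{R}^{n\times r}$ has i.i.d. standard normal entries. A (possibly randomized) adaptive algorithm making $k$ matrix-vector queries to an unknown matrix $A \in \mathbb{R}^{n\times n}$ chooses vectors $v_1, \ldots, v_k \in \mathbb{R}^n$ successively, where $v_{j}$ may depend (measurably) on the algorithm's internal randomness, which is independent of $A$, and on the previous answers $Av_1, \ldots, Av_{j-1}$; it then outputs a decision that is a measurable function of its internal randomness and of $Av_1,\ldots,Av_k$. **Theorem.** There are absolute constants $C_1, C_2 > 0$ such that the following holds for all $n, r, k \in \mathbb{N}$ with $r \ge C_1$ and $n \ge C_2 r$. Let $A$ be drawn from $\mathcal{D}_1 = W(n,r)$ or from $\mathcal{D}_2 = W(n,r+2)$, each with probability $1/2$. If an adaptive algorithm making $k$ matrix-vector queries to $A$ decides correctly, with probability at least $2/3$ (over the choice of distribution, of $A$, and of the internal randomness), which of $\mathcal{D}_1$ and $\mathcal{D}_2$ the matrix $A$ was drawn from, then $k \ge r/10$. -/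

import Mathlib

open MeasureTheory ProbabilityTheory
open scoped Matrix

/-- The Borel (entrywise product) `σ`-algebra on real matrices. -/
instance instMeasurableSpaceRealMatrix {m n : Type*} : MeasurableSpace (Matrix m n ℝ) :=
  inferInstanceAs (MeasurableSpace (m → n → ℝ))

/-- The law of an `n × r` real matrix with i.i.d. standard normal entries. -/
noncomputable def gaussianMatrix (n r : ℕ) : Measure (Matrix (Fin n) (Fin r) ℝ) :=
  Measure.pi fun _ : Fin n => Measure.pi fun _ : Fin r => gaussianReal 0 1

/-- The `n`-dimensional Wishart distribution with `r` degrees of freedom: the law of `G * Gᵀ`,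
where `G` is an `n × r` real matrix with i.i.d. standard normal entries. -/
noncomputable def wishart (n r : ℕ) : Measure (Matrix (Fin n) (Fin n) ℝ) :=
  (gaussianMatrix n r).map fun G => G * Gᵀ

/-- A (possibly randomized) adaptive algorithm that makes `k` matrix-vector queries to an unknown
`n × n` matrix and then outputs one bit. The internal randomness is a seed in `Ω`. The `j`-th query
vector is a measurable function of the seed and of the answers to the `j` preceding queries; the
output bit is a measurable function of the seed and of all `k` answers. -/
structure MatVecAlgorithm (Ω : Type*) [MeasurableSpace Ω] (n k : ℕ) where
  query : (j : Fin k) → Ω × (Fin j → Fin n → ℝ) → (Fin n → ℝ)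
  measurable_query : ∀ j, Measurable (query j)
  output : Ω × (Fin k → Fin n → ℝ) → Bool
  measurable_output : Measurable output

namespace MatVecAlgorithm

variable {Ω : Type*} [MeasurableSpace Ω] {n k : ℕ}

/-- The answers to the first `j` queries when the algorithm runs with seed `ω` on the matrix `A`:
the answer to a query vector `v` is `A *ᵥ v`. -/
def answers (alg : MatVecAlgorithm Ω n k) (A : Matrix (Fin n) (Fin n) ℝ) (ω : Ω) :
    (j : ℕ) → j ≤ k → (Fin j → Fin n → ℝ)
  | 0, _ => Fin.elim0
  | j + 1, h =>
    let past := alg.answers A ω j (Nat.le_of_succ_le h)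
    Fin.snoc (α := fun _ => Fin n → ℝ) past (A *ᵥ alg.query ⟨j, h⟩ (ω, past))

/-- The output bit when the algorithm runs with seed `ω` on the matrix `A`. -/
def run (alg : MatVecAlgorithm Ω n k) (A : Matrix (Fin n) (Fin n) ℝ) (ω : Ω) : Bool :=
  alg.output (ω, alg.answers A ω k le_rfl)

/-- The probability that the algorithm decides correctly between `D₁` and `D₂`, when the matrix is
drawn from `D₁` or `D₂` with probability `1 / 2` each, and, independently, the seed is drawn from
`P`. The output `false` is the decision for `D₁`, the output `true` is the decision for `D₂`. -/
noncomputable def successProb (alg : MatVecAlgorithm Ω n k) (P : Measure Ω)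
    (D₁ D₂ : Measure (Matrix (Fin n) (Fin n) ℝ)) : ℝ :=
  1 / 2 * (D₁.prod P).real {p | alg.run p.1 p.2 = false} +
    1 / 2 * (D₂.prod P).real {p | alg.run p.1 p.2 = true}

end MatVecAlgorithm

-- Write A = G Gᵀ and let v be the first query. Rotating G on the left makes v a multiple of the
-- first basis vector. Rotating it on the right moves the first row g of G to (‖g‖, 0, …, 0).
-- Gaussian invariance then splits A in law as p pᵀ + N A' Nᵀ, where p depends only on v, ‖g‖²
-- (chi-squared) and Gaussian noise z, where Nᵀ v = 0, and where A' is an independent Wishart matrix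
-- with dimension and degrees of freedom both lowered by one (`lintegral_wishart_succ`). The answer
-- A v sees only p, and each later query to A reduces to one query to A'. By induction, k adaptive
-- queries carry no more information about r than independent chi-squared variables with r, r - 1,
-- …, r - k + 1 degrees of freedom (`IsAdaptive.exists_simulation`).
--
-- Raising the degrees of freedom from s to s + 2 multiplies the chi-squared density by t / s
-- (`chiSq_add_two`). The likelihood ratio is therefore a product of such factors, and its second
-- moment telescopes to (r + 2)(r + 1) / ((r - k + 2)(r - k + 1)). For k < r / 10 this is at most
-- 100 / 81, whereas success probability 2/3 would force it to be at least 17 / 12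
-- (`chiSq_test_advantage`).

universe u

/-! ### Gaussian matrices: orthogonal invariance and splitting. -/

/-- The standard Gaussian measure on `ι → ℝ` is invariant under orthogonal matrices. -/
lemma measurePreserving_mulVec_of_orthogonal {ι : Type*} [Fintype ι] [DecidableEq ι]
    (O : Matrix ι ι ℝ) (hO : Oᵀ * O = 1) :
    MeasurePreserving (fun x => O *ᵥ x) (Measure.pi fun _ : ι => gaussianReal 0 1)
      (Measure.pi fun _ : ι => gaussianReal 0 1) := by
  have hm : Measurable (fun x : ι → ℝ => O *ᵥ x) := by
    have : Continuous (fun x : ι → ℝ => O *ᵥ x) := by fun_prop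
    exact this.measurable
  refine ⟨hm, ?_⟩
  let f₀ : EuclideanSpace ℝ ι →ₗᵢ[ℝ] EuclideanSpace ℝ ι :=
    { toLinearMap := Matrix.toEuclideanLin O
      norm_map' := by
        intro x
        have h : ‖Matrix.toEuclideanLin O x‖ ^ 2 = ‖x‖ ^ 2 := by
          rw [EuclideanSpace.real_norm_sq_eq, EuclideanSpace.real_norm_sq_eq]
          have : (O *ᵥ x.ofLp) ⬝ᵥ (O *ᵥ x.ofLp) = x.ofLp ⬝ᵥ x.ofLp := by
            rw [Matrix.dotProduct_mulVec, Matrix.vecMul_mulVec, hO, Matrix.vecMul_one]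
          simpa [dotProduct, pow_two, Matrix.toEuclideanLin] using this
        exact (sq_eq_sq₀ (norm_nonneg _) (norm_nonneg _)).1 h }
  let f := f₀.toLinearIsometryEquiv rfl
  have h1 := stdGaussian_map f
  rw [← map_pi_eq_stdGaussian, Measure.map_map (by fun_prop) (by fun_prop)] at h1
  have h2 := congrArg (Measure.map (WithLp.ofLp (p := 2) (V := ι → ℝ))) h1
  rw [Measure.map_map (by fun_prop) (by fun_prop),
    Measure.map_map (by fun_prop) (by fun_prop)] at h2
  have e1 : (WithLp.ofLp (p := 2) (V := ι → ℝ)) ∘ (⇑f ∘ WithLp.toLp 2) = fun x => O *ᵥ x := by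
    ext x i
    simp [f, f₀, Matrix.toEuclideanLin]
  have e2 : (WithLp.ofLp (p := 2) (V := ι → ℝ)) ∘ WithLp.toLp 2 = id := rfl
  rwa [e1, e2, Measure.map_id] at h2

/-- The Gaussian matrix as a Gaussian vector indexed by pairs. -/
lemma measurePreserving_uncurry_gaussianMatrix (n r : ℕ) :
    MeasurePreserving (fun (x : Fin n × Fin r → ℝ) => (Matrix.of fun i j => x (i, j) : Matrix (Fin n) (Fin r) ℝ))
      (Measure.pi fun _ => gaussianReal 0 1) (gaussianMatrix n r) := by
  refine ⟨?_, ?_⟩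
  · exact measurable_pi_iff.2 fun i => measurable_pi_iff.2 fun j => measurable_pi_apply _
  · have := Measure.infinitePi_map_curry (ι := Fin n) (κ := Fin r) (fun _ _ => gaussianReal 0 1)
    simp only [Measure.infinitePi_eq_pi] at this
    exact this

lemma measurePreserving_transpose_gaussianMatrix (n r : ℕ) :
    MeasurePreserving (fun G : Matrix (Fin n) (Fin r) ℝ => Gᵀ)
      (gaussianMatrix n r) (gaussianMatrix r n) := by
  have hm : Measurable (fun G : Matrix (Fin n) (Fin r) ℝ => Gᵀ) :=
    measurable_pi_iff.2 fun i => measurable_pi_iff.2 fun j =>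
      (measurable_pi_apply i).comp (measurable_pi_apply j)
  refine ⟨hm, ?_⟩
  have h1 := measurePreserving_uncurry_gaussianMatrix n r
  have h2 := measurePreserving_uncurry_gaussianMatrix r n
  have h3 := measurePreserving_piCongrLeft (fun _ : Fin r × Fin n => gaussianReal 0 1)
    (Equiv.prodComm (Fin n) (Fin r))
  rw [← h1.map_eq, Measure.map_map hm h1.measurable, ← (h2.comp h3).map_eq]
  congr 1

instance (n r : ℕ) : IsProbabilityMeasure (gaussianMatrix n r) :=
  inferInstanceAs (IsProbabilityMeasure (Measure.pi fun _ : Fin n =>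
    Measure.pi fun _ : Fin r => gaussianReal 0 1))

lemma measurePreserving_mul_right_gaussianMatrix {n r : ℕ} (O : Matrix (Fin r) (Fin r) ℝ)
    (hO : O * Oᵀ = 1) :
    MeasurePreserving (fun G : Matrix (Fin n) (Fin r) ℝ => G * O)
      (gaussianMatrix n r) (gaussianMatrix n r) := by
  have h := measurePreserving_mulVec_of_orthogonal Oᵀ (by simpa using hO)
  have := measurePreserving_pi (fun _ : Fin n => Measure.pi fun _ : Fin r => gaussianReal 0 1)
    (fun _ : Fin n => Measure.pi fun _ : Fin r => gaussianReal 0 1) (fun _ => h)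
  have e : (fun G : Matrix (Fin n) (Fin r) ℝ => G * O) = fun G i => Oᵀ *ᵥ G i := by
    ext G i j
    simp [Matrix.mul_apply, Matrix.mulVec, dotProduct, mul_comm]
  rw [e]
  exact this

lemma measurePreserving_mul_left_gaussianMatrix {n r : ℕ} (O : Matrix (Fin n) (Fin n) ℝ)
    (hO : Oᵀ * O = 1) :
    MeasurePreserving (fun G : Matrix (Fin n) (Fin r) ℝ => O * G)
      (gaussianMatrix n r) (gaussianMatrix n r) := by
  have h := (measurePreserving_transpose_gaussianMatrix r n).comp
    ((measurePreserving_mul_right_gaussianMatrix (n := r) Oᵀ (by simpa using hO)).comp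
      (measurePreserving_transpose_gaussianMatrix n r))
  convert h using 1
  ext G i j
  change (O * G) i j = (Gᵀ * Oᵀ) j i
  rw [← Matrix.transpose_mul, Matrix.transpose_apply]

/-- The matrix with first row `g`, followed by the rows of `G`. -/
def consRow {n r : ℕ} (g : Fin r → ℝ) (G : Matrix (Fin n) (Fin r) ℝ) :
    Matrix (Fin (n + 1)) (Fin r) ℝ :=
  Matrix.of (Fin.cons g fun i => G i)

/-- The matrix with first column `z`, followed by the columns of `G`. -/
def consCol {n r : ℕ} (z : Fin n → ℝ) (G : Matrix (Fin n) (Fin r) ℝ) :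
    Matrix (Fin n) (Fin (r + 1)) ℝ :=
  Matrix.of fun i => Fin.cons (z i) (G i)

/-- A Gaussian matrix splits into its first row and the remaining rows, which are independent. -/
lemma measurePreserving_consRow_gaussianMatrix (n r : ℕ) :
    MeasurePreserving (fun p : (Fin r → ℝ) × Matrix (Fin n) (Fin r) ℝ => consRow p.1 p.2)
      ((Measure.pi fun _ => gaussianReal 0 1).prod (gaussianMatrix n r))
      (gaussianMatrix (n + 1) r) := by
  have := (measurePreserving_piFinSuccAbove
    (fun _ : Fin (n + 1) => Measure.pi fun _ : Fin r => gaussianReal 0 1) 0).symm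
  have e : (fun p : (Fin r → ℝ) × Matrix (Fin n) (Fin r) ℝ => consRow p.1 p.2) =
      (MeasurableEquiv.piFinSuccAbove (fun _ : Fin (n + 1) => Fin r → ℝ) 0).symm := by
    funext p
    exact (Fin.insertNth_zero (α := fun _ => Fin r → ℝ) p.1 p.2).symm
  rw [e]
  exact this

/-- A Gaussian matrix splits into its first column and the remaining columns, which are
independent. -/
lemma measurePreserving_consCol_gaussianMatrix (n r : ℕ) :
    MeasurePreserving (fun p : (Fin n → ℝ) × Matrix (Fin n) (Fin r) ℝ => consCol p.1 p.2)
      ((Measure.pi fun _ => gaussianReal 0 1).prod (gaussianMatrix n r))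
      (gaussianMatrix n (r + 1)) := by
  have h := (measurePreserving_transpose_gaussianMatrix (r + 1) n).comp
    ((measurePreserving_consRow_gaussianMatrix r n).comp
      ((MeasurePreserving.id _).prod (measurePreserving_transpose_gaussianMatrix n r)))
  convert h using 1
  ext p i j
  refine Fin.cases ?_ (fun j => ?_) j <;> rfl

/-! ### Product densities and the chi-squared distribution. -/

lemma lintegral_pi_prod_eq_prod {n : ℕ} (μ : Fin n → Measure ℝ) [∀ i, SigmaFinite (μ i)]
    (f : Fin n → ℝ → ENNReal) (hf : ∀ i, Measurable (f i)) :
    ∫⁻ x, ∏ i, f i (x i) ∂Measure.pi μ = ∏ i, ∫⁻ t, f i t ∂μ i := by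
  induction n with
  | zero => simp
  | succ n ih =>
    have h := (measurePreserving_piFinSuccAbove μ 0).symm
    have hm : Measurable fun x : Fin n → ℝ => ∏ i, f (Fin.succ i) (x i) :=
      Finset.measurable_prod _ fun i _ => (hf _).comp (measurable_pi_apply i)
    rw [← h.lintegral_comp_emb (MeasurableEquiv.measurableEmbedding _), Fin.prod_univ_succ,
      ← ih (fun i => μ i.succ) (fun i => f i.succ) (fun i => hf _),
      ← lintegral_prod_mul (hf 0).aemeasurable hm.aemeasurable]
    simp [MeasurableEquiv.piFinSuccAbove_symm_apply, Fin.prod_univ_succ, Fin.insertNthEquiv]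

/-- Serves twice: for the Gaussian density on ℝˢ, and for the likelihood ratio between two products
of chi-squared laws. -/
lemma pi_withDensity_eq {n : ℕ} (μ : Fin n → Measure ℝ) [∀ i, SigmaFinite (μ i)]
    (f : Fin n → ℝ → ENNReal) (hf : ∀ i, Measurable (f i))
    [∀ i, SigmaFinite ((μ i).withDensity (f i))] :
    Measure.pi (fun i => (μ i).withDensity (f i)) =
      (Measure.pi μ).withDensity fun x => ∏ i, f i (x i) := by
  refine Measure.pi_eq fun s hs => ?_
  rw [withDensity_apply _ (MeasurableSet.univ_pi hs), Measure.restrict_pi_pi,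
    lintegral_pi_prod_eq_prod _ _ hf]
  exact Finset.prod_congr rfl fun i _ => (withDensity_apply _ (hs i)).symm

/-- The chi-squared distribution with `s` degrees of freedom. -/
noncomputable def chiSq (s : ℕ) : Measure ℝ :=
  (Measure.pi fun _ : Fin s => gaussianReal 0 1).map fun x => ∑ i, x i ^ 2

lemma measurable_sum_sq (s : ℕ) : Measurable fun x : Fin s → ℝ => ∑ i, x i ^ 2 := by fun_prop

instance (s : ℕ) : IsProbabilityMeasure (chiSq s) :=
  Measure.isProbabilityMeasure_map (measurable_sum_sq s).aemeasurable

lemma prod_gaussianPDFReal {s : ℕ} (x : Fin s → ℝ) :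
    ∏ i, gaussianPDFReal 0 1 (x i) =
      (Real.sqrt (2 * Real.pi))⁻¹ ^ s * Real.exp (-(∑ i, x i ^ 2) / 2) := by
  simp [gaussianPDFReal, Finset.prod_mul_distrib, ← Real.exp_sum, Finset.sum_div, neg_div]

/-- Polar coordinates for the Gaussian density. The constant stays anonymous because later it is
fixed by normalization. -/
lemma integral_chiSq_polar (s : ℕ) (hs : 1 ≤ s) :
    ∃ C : ℝ, ∀ f : ℝ → ℝ, Measurable f → ∫ t, f t ∂chiSq s =
      C * ∫ y in Set.Ioi (0 : ℝ), y ^ (s - 1) * (Real.exp (-y ^ 2 / 2) * f (y ^ 2)) := by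
  have : Nonempty (Fin s) := ⟨⟨0, hs⟩⟩
  refine ⟨(Real.sqrt (2 * Real.pi))⁻¹ ^ s * (s * volume.real (Metric.ball (0 : EuclideanSpace ℝ (Fin s)) 1)), fun f hf => ?_⟩
  rw [chiSq, integral_map (measurable_sum_sq s).aemeasurable hf.aestronglyMeasurable]
  have hpi : (Measure.pi fun _ : Fin s => gaussianReal 0 1) =
      (volume : Measure (Fin s → ℝ)).withDensity fun x => ∏ i, gaussianPDF 0 1 (x i) := by
    have : SigmaFinite ((volume : Measure ℝ).withDensity (gaussianPDF 0 1)) := by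
      rw [← gaussianReal_of_var_ne_zero 0 one_ne_zero]; infer_instance
    rw [gaussianReal_of_var_ne_zero 0 one_ne_zero,
      pi_withDensity_eq (fun _ => volume) (fun _ => gaussianPDF 0 1)
        (fun _ => measurable_gaussianPDF 0 1)]
    rfl
  have hm : Measurable fun x : Fin s → ℝ => ∏ i, gaussianPDF 0 1 (x i) :=
    Finset.measurable_prod _ fun i _ => (measurable_gaussianPDF 0 1).comp (measurable_pi_apply i)
  rw [hpi, integral_withDensity_eq_integral_toReal_smul hm
    (.of_forall fun x => ENNReal.prod_lt_top fun i _ => gaussianPDF_lt_top)]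
  have key := integral_fun_norm_addHaar (volume : Measure (EuclideanSpace ℝ (Fin s)))
    (fun y => Real.exp (-y ^ 2 / 2) * f (y ^ 2))
  rw [← (PiLp.volume_preserving_toLp (Fin s)).integral_comp
    (MeasurableEquiv.toLp 2 _).measurableEmbedding] at key
  simp only [EuclideanSpace.real_norm_sq_eq, finrank_euclideanSpace, Fintype.card_fin,
    smul_eq_mul, nsmul_eq_mul] at key
  rw [mul_assoc, mul_assoc, ← key, ← integral_const_mul]
  refine integral_congr_ae (.of_forall fun x => ?_)
  simp only [ENNReal.toReal_prod, toReal_gaussianPDF, prod_gaussianPDFReal, smul_eq_mul]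
  ring

lemma integrable_eval_sq (s : ℕ) (i : Fin s) :
    Integrable (fun x : Fin s → ℝ => x i ^ 2) (Measure.pi fun _ : Fin s => gaussianReal 0 1) := by
  have h := (memLp_id_gaussianReal' (μ := 0) (v := 1) 2 (by simp)).integrable_sq
  exact integrable_comp_eval (μ := fun _ : Fin s => gaussianReal 0 1) (i := i) h

lemma integrable_id_chiSq (s : ℕ) : Integrable (fun t => t) (chiSq s) := by
  rw [chiSq, integrable_map_measure (by fun_prop) (measurable_sum_sq s).aemeasurable]
  exact integrable_finsetSum _ fun i _ => integrable_eval_sq s i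

lemma integral_id_chiSq (s : ℕ) : ∫ t, t ∂chiSq s = s := by
  rw [chiSq, integral_map (measurable_sum_sq s).aemeasurable (by fun_prop),
    integral_finsetSum _ fun i _ => integrable_eval_sq s i]
  have h1 : ∫ t, t ^ 2 ∂gaussianReal 0 1 = 1 := by
    have := variance_of_integral_eq_zero (μ := gaussianReal 0 1) (X := id) (by fun_prop) (by simp)
    rw [variance_id_gaussianReal] at this
    simpa using this.symm
  have h2 (i : Fin s) : ∫ x : Fin s → ℝ, x i ^ 2 ∂(Measure.pi fun _ => gaussianReal 0 1) = 1 := by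
    rw [← h1]
    exact integral_comp_eval (μ := fun _ : Fin s => gaussianReal 0 1) (i := i)
      (f := fun t : ℝ => t ^ 2) (by fun_prop)
  simp [h2]

lemma chiSq_ae_nonneg (s : ℕ) : ∀ᵐ t ∂chiSq s, 0 ≤ t := by
  rw [chiSq, ae_map_iff (measurable_sum_sq s).aemeasurable measurableSet_Ici]
  exact .of_forall fun x => Finset.sum_nonneg fun i _ => sq_nonneg _

/-- The radial densities for s and s + 2 differ by y² = t and a constant; total mass one and the
mean s identify the constant as 1 / s. -/
lemma integral_chiSq_add_two (s : ℕ) (hs : 1 ≤ s) (f : ℝ → ℝ) (hf : Measurable f) :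
    ∫ t, f t ∂chiSq (s + 2) = ∫ t, t / s * f t ∂chiSq s := by
  obtain ⟨C, hC⟩ := integral_chiSq_polar s hs
  obtain ⟨D, hD⟩ := integral_chiSq_polar (s + 2) (by omega)
  have hJ : ∀ g : ℝ → ℝ, Measurable g → C * ∫ t, g t ∂chiSq (s + 2) = D * ∫ t, t * g t ∂chiSq s := by
    intro g hg
    rw [hD g hg, hC (fun t => t * g t) (measurable_id.mul hg)]
    rw [← mul_assoc, ← mul_assoc, mul_comm C D]
    congr 1
    refine integral_congr_ae (.of_forall fun y => ?_)
    have : s + 2 - 1 = (s - 1) + 2 := by omega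
    simp only [this, pow_add]
    ring
  -- Testing against 1 gives C = D * s.
  have h1 := hJ (fun _ => 1) measurable_const
  have hC0 : C ≠ 0 := by
    rintro rfl
    have := hC (fun _ => 1) measurable_const
    simp at this
  simp only [mul_one, integral_id_chiSq, integral_const, probReal_univ, smul_eq_mul] at h1
  have h2 := hJ f hf
  have : ∫ t, t / s * f t ∂chiSq s = (s : ℝ)⁻¹ * ∫ t, t * f t ∂chiSq s := by
    rw [← integral_const_mul]
    congr 1; ext t; ring
  rw [this]
  have h3 : C * (∫ t, f t ∂chiSq (s + 2)) = C * ((s : ℝ)⁻¹ * ∫ t, t * f t ∂chiSq s) := by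
    rw [h2, h1]; field_simp
  exact mul_left_cancel₀ hC0 h3

lemma chiSq_add_two (s : ℕ) (hs : 1 ≤ s) :
    chiSq (s + 2) = (chiSq s).withDensity fun t => ENNReal.ofReal (t / s) := by
  ext B hB
  have h := integral_chiSq_add_two s hs (B.indicator 1) (measurable_const.indicator hB)
  rw [withDensity_apply _ hB, ← ofReal_integral_eq_lintegral_ofReal
    ((integrable_id_chiSq s).div_const _).restrict
    (ae_restrict_of_ae ((chiSq_ae_nonneg s).mono fun t ht => by positivity)),
    ← integral_indicator hB, ← ofReal_measureReal, ← integral_indicator_one hB, h]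
  congr 2
  ext t
  by_cases ht : t ∈ B <;> simp [ht]

/-- Size-biasing turns one factor t / s into a shift of s by two, leaving the mean of `chiSq (s +
2)` divided by s. -/
lemma integral_sq_chiSq (s : ℕ) (hs : 1 ≤ s) : ∫ t, (t / s) ^ 2 ∂chiSq s = (s + 2) / s := by
  have h := integral_chiSq_add_two s hs (fun t => t / s) (by fun_prop)
  rw [integral_div, integral_id_chiSq] at h
  push_cast at h
  rw [h]
  congr 1; ext t; ring

lemma integrable_sq_chiSq (s : ℕ) (hs : 1 ≤ s) : Integrable (fun t : ℝ => (t / s) ^ 2) (chiSq s) := by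
  have : 0 < (s : ℝ) := by positivity
  -- A non-integrable function has integral 0 by convention, so a nonzero integral implies
  -- integrability.
  refine not_imp_comm.1 integral_undef ?_
  rw [integral_sq_chiSq s hs]
  positivity

/-! ### Measurability of matrix operations. -/

lemma measurable_matrix_iff {α m n : Type*} [MeasurableSpace α] {f : α → Matrix m n ℝ} :
    Measurable f ↔ ∀ i j, Measurable fun a => f a i j :=
  measurable_pi_iff.trans (forall_congr' fun _ => measurable_pi_iff)

section Measurability

variable {α m n p : Type*} [MeasurableSpace α]

lemma Measurable.matrix_apply {f : α → Matrix m n ℝ} (hf : Measurable f) (i : m) (j : n) :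
    Measurable fun a => f a i j :=
  measurable_matrix_iff.1 hf i j

lemma Measurable.matrix_mul [Fintype n] {f : α → Matrix m n ℝ} {g : α → Matrix n p ℝ} (hf : Measurable f)
    (hg : Measurable g) : Measurable fun a => f a * g a :=
  measurable_matrix_iff.2 fun i j => by
    simp only [Matrix.mul_apply]
    exact Finset.measurable_sum _ fun k _ =>
      (measurable_matrix_iff.1 hf i k).mul (measurable_matrix_iff.1 hg k j)

lemma Measurable.matrix_add {f g : α → Matrix m n ℝ} (hf : Measurable f) (hg : Measurable g) :
    Measurable fun a => f a + g a :=
  measurable_matrix_iff.2 fun i j => (hf.matrix_apply i j).add (hg.matrix_apply i j)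

lemma Measurable.matrix_transpose {f : α → Matrix m n ℝ} (hf : Measurable f) :
    Measurable fun a => (f a)ᵀ :=
  measurable_matrix_iff.2 fun i j => hf.matrix_apply j i

lemma Measurable.matrix_mulVec [Fintype n] {f : α → Matrix m n ℝ} {g : α → n → ℝ} (hf : Measurable f)
    (hg : Measurable g) : Measurable fun a => f a *ᵥ g a :=
  measurable_pi_iff.2 fun i => Finset.measurable_sum _ fun k _ =>
    (hf.matrix_apply i k).mul (measurable_pi_iff.1 hg k)

end Measurability

/-! ### Householder reflections, measurable in the vector. -/

/-- The Householder reflection that maps `v` to a nonnegative multiple of the first basis vector. -/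
noncomputable def householder {n : ℕ} (v : Fin (n + 1) → ℝ) :
    Matrix (Fin (n + 1)) (Fin (n + 1)) ℝ :=
  let w := v - Pi.single 0 (Real.sqrt (v ⬝ᵥ v))
  1 - (2 / (w ⬝ᵥ w)) • Matrix.vecMulVec w w

lemma householder_transpose {n : ℕ} (v : Fin (n + 1) → ℝ) : (householder v)ᵀ = householder v := by
  simp [householder, Matrix.transpose_sub, Matrix.transpose_smul, Matrix.transpose_vecMulVec]

lemma householder_mul_self {n : ℕ} (v : Fin (n + 1) → ℝ) :
    householder v * householder v = 1 := by
  simp only [householder]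
  set w := v - Pi.single 0 (Real.sqrt (v ⬝ᵥ v)) with hw
  have h : Matrix.vecMulVec w w * Matrix.vecMulVec w w = (w ⬝ᵥ w) • Matrix.vecMulVec w w := by
    rw [Matrix.vecMulVec_mul_vecMulVec, Matrix.vecMulVec_smul]
  rw [sub_mul, mul_sub, one_mul, one_mul, mul_sub, mul_one, smul_mul_smul_comm, h, smul_smul]
  -- For w = 0 the convention 2 / 0 = 0 makes the reflection the identity.
  by_cases h0 : w ⬝ᵥ w = 0
  · simp [h0]
  · have : 2 / (w ⬝ᵥ w) * (2 / (w ⬝ᵥ w)) * (w ⬝ᵥ w) = 2 / (w ⬝ᵥ w) + 2 / (w ⬝ᵥ w) := by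
      field_simp; norm_num
    rw [this, add_smul]
    abel

lemma householder_mulVec_self {n : ℕ} (v : Fin (n + 1) → ℝ) :
    householder v *ᵥ v = Pi.single 0 (Real.sqrt (v ⬝ᵥ v)) := by
  simp only [householder]
  set a := Real.sqrt (v ⬝ᵥ v) with ha
  set w := v - Pi.single 0 a with hw
  have haa : a * a = v ⬝ᵥ v := Real.mul_self_sqrt (Finset.sum_nonneg fun i _ => mul_self_nonneg _)
  have h1 : w ⬝ᵥ v = v ⬝ᵥ v - a * v 0 := by simp [hw, sub_dotProduct]
  -- This expresses that v and its target have equal norm, so reflecting in w carries one to the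
  -- other.
  have h2 : w ⬝ᵥ w = 2 * (w ⬝ᵥ v) := by
    have h3 : w 0 = v 0 - a := by simp [hw]
    have h4 : w ⬝ᵥ w = w ⬝ᵥ v - w 0 * a := by
      conv_lhs => rw [hw, dotProduct_sub, ← hw, dotProduct_single]
    rw [h4, h3, h1]
    linarith
  rw [Matrix.sub_mulVec, Matrix.one_mulVec, Matrix.smul_mulVec, Matrix.vecMulVec_mulVec]
  by_cases h0 : w ⬝ᵥ w = 0
  · rw [h0, div_zero, zero_smul, sub_zero]
    exact sub_eq_zero.1 (dotProduct_self_eq_zero.1 h0)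
  · have : (2 / (w ⬝ᵥ w)) • MulOpposite.op (w ⬝ᵥ v) • w = w := by
      rw [op_smul_eq_smul, smul_smul, h2]
      have : w ⬝ᵥ v ≠ 0 := by rintro h; simp [h2, h] at h0
      rw [show 2 / (2 * (w ⬝ᵥ v)) * (w ⬝ᵥ v) = 1 by field_simp, one_smul]
    rw [this, hw, sub_sub_cancel]

lemma measurable_householder {n : ℕ} : Measurable (householder (n := n)) := by
  have hw : ∀ i, Measurable fun v : Fin (n + 1) → ℝ =>
      (v - Pi.single 0 (Real.sqrt (v ⬝ᵥ v)) : Fin (n + 1) → ℝ) i := by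
    intro i
    have : Measurable fun v : Fin (n + 1) → ℝ => Real.sqrt (v ⬝ᵥ v) := by
      unfold dotProduct; fun_prop
    simp only [Pi.sub_apply, Pi.single_apply]
    split_ifs
    · exact (measurable_pi_apply i).sub this
    · exact (measurable_pi_apply i).sub measurable_const
  refine measurable_matrix_iff.2 fun i j => ?_
  simp only [householder, Matrix.sub_apply, Matrix.smul_apply, Matrix.vecMulVec_apply, smul_eq_mul]
  refine measurable_const.sub (Measurable.mul (measurable_const.div ?_) ((hw i).mul (hw j)))
  exact Finset.measurable_sum _ fun k _ => (hw k).mul (hw k)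

/-- The columns of the Householder reflection of `v` except the first: an orthonormal basis of a
hyperplane orthogonal to `v`. -/
noncomputable def orthoFrame {n : ℕ} (v : Fin (n + 1) → ℝ) : Matrix (Fin (n + 1)) (Fin n) ℝ :=
  (householder v).submatrix id Fin.succ

lemma orthoFrame_transpose_mulVec {n : ℕ} (v : Fin (n + 1) → ℝ) : (orthoFrame v)ᵀ *ᵥ v = 0 := by
  ext i
  have := congrFun (householder_mulVec_self v) i.succ
  rw [← householder_transpose] at this
  simpa [orthoFrame, Matrix.mulVec, dotProduct] using this

lemma measurable_orthoFrame {n : ℕ} : Measurable (orthoFrame (n := n)) :=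
  measurable_matrix_iff.2 fun i j => measurable_householder.matrix_apply i j.succ

/-! ### What one query reveals about a Wishart matrix. -/

/-- The rank one matrix that the answer to the query `v` reveals. -/
noncomputable def rankOnePart {n : ℕ} (v : Fin (n + 1) → ℝ) (b : ℝ) (z : Fin n → ℝ) :
    Matrix (Fin (n + 1)) (Fin (n + 1)) ℝ :=
  let p : Fin (n + 1) → ℝ := householder v *ᵥ Fin.cons (Real.sqrt b) z
  Matrix.vecMulVec p p

lemma Measurable.rankOnePart {α : Type*} [MeasurableSpace α] {n : ℕ} {v : α → Fin (n + 1) → ℝ}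
    {b : α → ℝ} {z : α → Fin n → ℝ} (hv : Measurable v) (hb : Measurable b) (hz : Measurable z) :
    Measurable fun a => rankOnePart (v a) (b a) (z a) := by
  have h : Measurable fun a =>
      householder (v a) *ᵥ (Fin.cons (Real.sqrt (b a)) (z a) : Fin (n + 1) → ℝ) := by
    refine (measurable_householder.comp hv).matrix_mulVec ?_
    refine measurable_pi_iff.2 fun i => Fin.cases ?_ (fun i => ?_) i
    · simp only [Fin.cons_zero]; fun_prop
    · simp only [Fin.cons_succ]; fun_prop
  exact measurable_matrix_iff.2 fun i j =>
    (measurable_pi_iff.1 h i).mul (measurable_pi_iff.1 h j)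

/-- The Gram matrix is a sum over columns. The first column of the product is the vector in
`rankOnePart`; the others have zero top entry before reflection, so only `orthoFrame v` acts on
them. -/
lemma householder_mul_bordered {n r : ℕ} (v : Fin (n + 1) → ℝ) (a : ℝ) (z : Fin n → ℝ)
    (G : Matrix (Fin n) (Fin r) ℝ) (X : Matrix (Fin (n + 1)) (Fin (r + 1)) ℝ)
    (hX : X = consRow (Pi.single 0 (Real.sqrt a)) (consCol z G)) :
    (householder v * X) * (householder v * X)ᵀ =
      rankOnePart v a z + orthoFrame v * (G * Gᵀ) * (orthoFrame v)ᵀ := by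
  have hX0 : ∀ j, X 0 j = (Pi.single 0 (Real.sqrt a) : Fin (r + 1) → ℝ) j := by subst hX; exact fun _ => rfl
  have hX1 : ∀ i : Fin n, X i.succ 0 = z i := by subst hX; exact fun _ => rfl
  have hX2 : ∀ (i : Fin n) (j : Fin r), X i.succ j.succ = G i j := by subst hX; exact fun _ _ => rfl
  have h0 : ∀ i, (householder v * X) i 0 =
      (householder v *ᵥ (Fin.cons (Real.sqrt a) z : Fin (n + 1) → ℝ)) i := by
    intro i
    simp [Matrix.mul_apply, Matrix.mulVec, dotProduct, Fin.sum_univ_succ, hX0, hX1]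
  have hs : ∀ i (j : Fin r), (householder v * X) i j.succ = (orthoFrame v * G) i j := by
    intro i j
    simp [Matrix.mul_apply, Fin.sum_univ_succ, orthoFrame, hX0, hX2]
  have e : orthoFrame v * (G * Gᵀ) * (orthoFrame v)ᵀ = (orthoFrame v * G) * (orthoFrame v * G)ᵀ := by
    rw [Matrix.transpose_mul]; simp only [Matrix.mul_assoc]
  rw [e]
  ext i j
  rw [Matrix.add_apply, Matrix.mul_apply, Fin.sum_univ_succ,
    Matrix.mul_apply (M := orthoFrame v * G)]
  simp only [Matrix.transpose_apply, h0, hs, rankOnePart, Matrix.vecMulVec_apply]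

lemma measurable_mul_transpose_self (n r : ℕ) :
    Measurable fun G : Matrix (Fin n) (Fin r) ℝ => G * Gᵀ :=
  measurable_id.matrix_mul measurable_id.matrix_transpose

instance (n r : ℕ) : IsProbabilityMeasure (wishart n r) :=
  Measure.isProbabilityMeasure_map (measurable_mul_transpose_self n r).aemeasurable

/-- Replacing the first row `g` by `(‖g‖, 0, …, 0)` and leaving the other rows Gaussian does not
change the law of the Gram matrix. -/
lemma lintegral_rotate_first_row {n r : ℕ} (g : Fin (r + 1) → ℝ)
    (Φ : Matrix (Fin (n + 1)) (Fin (n + 1)) ℝ → ENNReal) (hΦ : Measurable Φ)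
    (O : Matrix (Fin (n + 1)) (Fin (n + 1)) ℝ) :
    ∫⁻ G, Φ ((O * consRow g G) * (O * consRow g G)ᵀ)
        ∂gaussianMatrix n (r + 1) =
      ∫⁻ G, Φ ((O * consRow (Pi.single 0 (Real.sqrt (g ⬝ᵥ g))) G) *
        (O * consRow (Pi.single 0 (Real.sqrt (g ⬝ᵥ g))) G)ᵀ)
        ∂gaussianMatrix n (r + 1) := by
  have hK : householder g * (householder g)ᵀ = 1 := by
    rw [householder_transpose, householder_mul_self]
  have hinv := measurePreserving_mul_right_gaussianMatrix (n := n) (householder g) hK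
  have hmeas : Measurable fun G : Matrix (Fin n) (Fin (r + 1)) ℝ =>
      Φ ((O * consRow g G) * (O * consRow g G)ᵀ) := by
    have h1 : Measurable fun G : Matrix (Fin n) (Fin (r + 1)) ℝ =>
        consRow g G :=
      (measurePreserving_consRow_gaussianMatrix n (r + 1)).measurable.comp measurable_prodMk_left
    have h2 := (measurable_const (a := O)).matrix_mul h1
    exact hΦ.comp (h2.matrix_mul h2.matrix_transpose)
  rw [← hinv.lintegral_comp hmeas]
  refine lintegral_congr fun G => ?_
  -- The reflection squares to 1 and sends g to the first axis, so it factors out on the right and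
  -- cancels in the Gram matrix.
  have hrow : consRow g (G * householder g) =
      consRow (Pi.single 0 (Real.sqrt (g ⬝ᵥ g))) G * householder g := by
    ext i j
    refine Fin.cases ?_ (fun i => ?_) i
    · rw [← householder_mulVec_self, Matrix.mul_apply_eq_vecMul]
      change g j = ((householder g *ᵥ g) ᵥ* householder g) j
      rw [← Matrix.mulVec_transpose, householder_transpose, Matrix.mulVec_mulVec,
        householder_mul_self, Matrix.one_mulVec]
    · rw [Matrix.mul_apply]
      exact Matrix.mul_apply (M := G) (N := householder g)
  rw [hrow, ← Matrix.mul_assoc, Matrix.transpose_mul _ (householder g), Matrix.mul_assoc _ (householder g),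
    ← Matrix.mul_assoc (householder g), hK, Matrix.one_mul]

/-- Once the first row is aligned, the remaining rows split into an independent first column z and a
block with one column fewer, whose Gram matrix is the smaller Wishart matrix. -/
lemma lintegral_aligned_first_row {n r : ℕ} (v : Fin (n + 1) → ℝ) (a : ℝ)
    (Φ : Matrix (Fin (n + 1)) (Fin (n + 1)) ℝ → ENNReal) (hΦ : Measurable Φ) :
    ∫⁻ G, Φ ((householder v * consRow (Pi.single 0 (Real.sqrt a)) G) *
        (householder v * consRow (Pi.single 0 (Real.sqrt a)) G)ᵀ) ∂gaussianMatrix n (r + 1) =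
      ∫⁻ z, ∫⁻ A, Φ (rankOnePart v a z + orthoFrame v * A * (orthoFrame v)ᵀ) ∂wishart n r
        ∂(Measure.pi fun _ : Fin n => gaussianReal 0 1) := by
  have hcols := measurePreserving_consCol_gaussianMatrix n r
  have hrest : Measurable fun G : Matrix (Fin n) (Fin (r + 1)) ℝ =>
      Φ ((householder v * consRow (Pi.single 0 (Real.sqrt a)) G) *
        (householder v * consRow (Pi.single 0 (Real.sqrt a)) G)ᵀ) := by
    have h1 : Measurable fun G : Matrix (Fin n) (Fin (r + 1)) ℝ =>
        consRow (Pi.single 0 (Real.sqrt a)) G :=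
      (measurePreserving_consRow_gaussianMatrix n (r + 1)).measurable.comp measurable_prodMk_left
    have h2 := (measurable_const (a := householder v)).matrix_mul h1
    exact hΦ.comp (h2.matrix_mul h2.matrix_transpose)
  have hrc : Measurable fun p : (Fin n → ℝ) × Matrix (Fin n) (Fin r) ℝ =>
      Φ ((householder v * consRow (Pi.single 0 (Real.sqrt a)) (consCol p.1 p.2)) *
        (householder v * consRow (Pi.single 0 (Real.sqrt a)) (consCol p.1 p.2))ᵀ) :=
    hrest.comp hcols.measurable
  rw [← hcols.lintegral_comp hrest, lintegral_prod _ hrc.aemeasurable]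
  refine lintegral_congr fun z => ?_
  have hmA : Measurable fun A : Matrix (Fin n) (Fin n) ℝ =>
      Φ (rankOnePart v a z + orthoFrame v * A * (orthoFrame v)ᵀ) :=
    hΦ.comp (measurable_const.matrix_add
      ((measurable_const.matrix_mul measurable_id).matrix_mul measurable_const))
  rw [wishart, lintegral_map hmA (measurable_mul_transpose_self _ _)]
  refine lintegral_congr fun G => ?_
  rw [householder_mul_bordered v _ z G _ rfl]

/-- One query reveals a chi-squared variable and independent noise; the rest of a Wishart matrix is
an independent Wishart matrix with one degree of freedom less, on the orthogonal complement of the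
query. -/
theorem lintegral_wishart_succ {n r : ℕ} (v : Fin (n + 1) → ℝ)
    (Φ : Matrix (Fin (n + 1)) (Fin (n + 1)) ℝ → ENNReal) (hΦ : Measurable Φ) :
    ∫⁻ A, Φ A ∂wishart (n + 1) (r + 1) =
      ∫⁻ b, ∫⁻ z, ∫⁻ A, Φ (rankOnePart v b z + orthoFrame v * A * (orthoFrame v)ᵀ) ∂wishart n r
        ∂(Measure.pi fun _ : Fin n => gaussianReal 0 1) ∂chiSq (r + 1) := by
  have hH : (householder v)ᵀ * householder v = 1 := by
    rw [householder_transpose, householder_mul_self]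
  have hmΦ : Measurable fun x : (ℝ × (Fin n → ℝ)) × Matrix (Fin n) (Fin n) ℝ =>
      Φ (rankOnePart v x.1.1 x.1.2 + orthoFrame v * x.2 * (orthoFrame v)ᵀ) := by
    refine hΦ.comp (Measurable.matrix_add ?_ ?_)
    · exact measurable_const.rankOnePart (by fun_prop) (by fun_prop)
    · exact ((measurable_const.matrix_mul measurable_snd).matrix_mul measurable_const)
  have hG : Measurable fun G : Matrix (Fin (n + 1)) (Fin (r + 1)) ℝ => Φ (G * Gᵀ) :=
    hΦ.comp (measurable_mul_transpose_self _ _)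
  have hHG : Measurable fun G : Matrix (Fin (n + 1)) (Fin (r + 1)) ℝ =>
      Φ ((householder v * G) * (householder v * G)ᵀ) := by
    have h := (measurable_const (a := householder v)).matrix_mul
      (measurable_id (α := Matrix (Fin (n + 1)) (Fin (r + 1)) ℝ))
    exact hΦ.comp (h.matrix_mul h.matrix_transpose)
  have hrows := measurePreserving_consRow_gaussianMatrix n (r + 1)
  have hHr : Measurable fun p : (Fin (r + 1) → ℝ) × Matrix (Fin n) (Fin (r + 1)) ℝ =>
      Φ ((householder v * consRow p.1 p.2) * (householder v * consRow p.1 p.2)ᵀ) :=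
    hHG.comp hrows.measurable
  have hmb : Measurable fun b : ℝ => ∫⁻ z, ∫⁻ A, Φ (rankOnePart v b z +
      orthoFrame v * A * (orthoFrame v)ᵀ) ∂wishart n r
        ∂(Measure.pi fun _ : Fin n => gaussianReal 0 1) := by
    have h1 : Measurable fun x : ℝ × (Fin n → ℝ) => ∫⁻ A, Φ (rankOnePart v x.1 x.2 +
        orthoFrame v * A * (orthoFrame v)ᵀ) ∂wishart n r :=
      hmΦ.lintegral_prod_right'
    exact h1.lintegral_prod_right'
  rw [wishart, lintegral_map hΦ (measurable_mul_transpose_self _ _),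
    ← (measurePreserving_mul_left_gaussianMatrix (householder v) hH).lintegral_comp hG,
    ← hrows.lintegral_comp hHG, lintegral_prod _ hHr.aemeasurable,
    chiSq, lintegral_map hmb (measurable_sum_sq _)]
  -- For fixed g, the remaining integral depends on g only through ‖g‖², whose law is `chiSq (r +
  -- 1)`.
  refine lintegral_congr fun g => ?_
  have hgg : ∑ i, g i ^ 2 = g ⬝ᵥ g := by simp [dotProduct, pow_two]
  rw [hgg, lintegral_rotate_first_row g Φ hΦ]
  exact lintegral_aligned_first_row v _ Φ hΦ

/-! ### Adaptive procedures and their simulation. -/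

/-- `Φ θ A` is the acceptance probability, given the parameter `θ`, of an adaptive procedure that
makes `k` matrix-vector queries to `A`. -/
def IsAdaptive {n : ℕ} : ℕ → ∀ (Θ : Type u) [MeasurableSpace Θ],
    (Θ → Matrix (Fin n) (Fin n) ℝ → ENNReal) → Prop
  | 0, Θ, _, Φ => ∃ f : Θ → ENNReal, Measurable f ∧ (∀ θ, f θ ≤ 1) ∧ ∀ θ A, Φ θ A = f θ
  | k + 1, Θ, _, Φ => ∃ v : Θ → Fin n → ℝ, Measurable v ∧
      ∃ Ψ : Θ × (Fin n → ℝ) → Matrix (Fin n) (Fin n) ℝ → ENNReal,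
        IsAdaptive k (Θ × (Fin n → ℝ)) Ψ ∧ ∀ θ A, Φ θ A = Ψ (θ, A *ᵥ v θ) A

namespace IsAdaptive

/-- Lets a procedure run on simulated answers, computed measurably from other data. -/
lemma comp_param {n k : ℕ} {Θ Θ' : Type u} [MeasurableSpace Θ] [MeasurableSpace Θ']
    {Φ : Θ → Matrix (Fin n) (Fin n) ℝ → ENNReal} (hΦ : IsAdaptive k Θ Φ) {g : Θ' → Θ}
    (hg : Measurable g) : IsAdaptive k Θ' fun θ => Φ (g θ) := by
  induction k generalizing Θ Θ' with
  | zero =>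
    obtain ⟨f, hf, hf1, h⟩ := hΦ
    exact ⟨f ∘ g, hf.comp hg, fun θ => hf1 _, fun θ A => h _ _⟩
  | succ k ih =>
    obtain ⟨v, hv, Ψ, hΨ, h⟩ := hΦ
    exact ⟨v ∘ g, hv.comp hg, fun q => Ψ (g q.1, q.2),
      ih hΨ ((hg.comp measurable_fst).prodMk measurable_snd), fun θ A => h _ _⟩

/-- A query to `M + N * A * Nᵀ` can be answered by a query to `A`. -/
lemma comp_affine {n m k : ℕ} {Θ : Type u} [MeasurableSpace Θ]
    {Φ : Θ → Matrix (Fin n) (Fin n) ℝ → ENNReal} (hΦ : IsAdaptive k Θ Φ)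
    {M : Θ → Matrix (Fin n) (Fin n) ℝ} (hM : Measurable M)
    {N : Θ → Matrix (Fin n) (Fin m) ℝ} (hN : Measurable N) :
    IsAdaptive k Θ fun θ (A : Matrix (Fin m) (Fin m) ℝ) => Φ θ (M θ + N θ * A * (N θ)ᵀ) := by
  induction k generalizing Θ with
  | zero =>
    obtain ⟨f, hf, hf1, h⟩ := hΦ
    exact ⟨f, hf, hf1, fun θ A => h _ _⟩
  | succ k ih =>
    obtain ⟨v, hv, Ψ, hΨ, h⟩ := hΦ
    have hg : Measurable fun q : Θ × (Fin m → ℝ) => (q.1, M q.1 *ᵥ v q.1 + N q.1 *ᵥ q.2) := by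
      have hM' : Measurable fun q : Θ × (Fin m → ℝ) => M q.1 := hM.comp measurable_fst
      have hN' : Measurable fun q : Θ × (Fin m → ℝ) => N q.1 := hN.comp measurable_fst
      exact measurable_fst.prodMk
        ((hM'.matrix_mulVec (hv.comp measurable_fst)).add (hN'.matrix_mulVec measurable_snd))
    refine ⟨fun θ => (N θ)ᵀ *ᵥ v θ, hN.matrix_transpose.matrix_mulVec hv, _,
      ih (hΨ.comp_param hg) (hM.comp measurable_fst) (hN.comp measurable_fst), fun θ A => ?_⟩
    refine (h _ _).trans ?_
    simp only [Function.comp_apply, Matrix.add_mulVec, Matrix.mulVec_mulVec, Matrix.mul_assoc]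

lemma measurable {n k : ℕ} {Θ : Type u} [MeasurableSpace Θ]
    {Φ : Θ → Matrix (Fin n) (Fin n) ℝ → ENNReal} (hΦ : IsAdaptive k Θ Φ) :
    Measurable fun q : Θ × Matrix (Fin n) (Fin n) ℝ => Φ q.1 q.2 := by
  induction k generalizing Θ with
  | zero =>
    obtain ⟨f, hf, -, h⟩ := hΦ
    simp only [h]
    exact hf.comp measurable_fst
  | succ k ih =>
    obtain ⟨v, hv, Ψ, hΨ, h⟩ := hΦ
    simp only [h]
    have hg : Measurable fun q : Θ × Matrix (Fin n) (Fin n) ℝ => ((q.1, q.2 *ᵥ v q.1), q.2) :=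
      (measurable_fst.prodMk (measurable_snd.matrix_mulVec (hv.comp measurable_fst))).prodMk
        measurable_snd
    exact (ih hΨ).comp hg

/-- On a Wishart matrix, `k` adaptive queries can be simulated from `k` independent chi-squared
variables, by a procedure that does not depend on the degrees of freedom. -/
theorem exists_simulation {n k : ℕ} {Θ : Type u} [MeasurableSpace Θ]
    {Φ : Θ → Matrix (Fin n) (Fin n) ℝ → ENNReal} (hΦ : IsAdaptive k Θ Φ) (hkn : k ≤ n) :
    ∃ h : Θ → (Fin k → ℝ) → ENNReal, (Measurable fun q : Θ × (Fin k → ℝ) => h q.1 q.2) ∧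
      (∀ θ x, h θ x ≤ 1) ∧ ∀ θ r, k ≤ r → ∫⁻ A, Φ θ A ∂wishart n r =
        ∫⁻ x, h θ x ∂Measure.pi fun i : Fin k => chiSq (r - i) := by
  induction k generalizing n Θ with
  | zero =>
    obtain ⟨f, hf, hf1, h⟩ := hΦ
    exact ⟨fun θ _ => f θ, hf.comp measurable_fst, fun θ _ => hf1 θ, fun θ r _ => by simp [h]⟩
  | succ k ih =>
    obtain ⟨n, rfl⟩ : ∃ m, n = m + 1 := ⟨n - 1, by omega⟩
    have hΦm := hΦ.measurable
    obtain ⟨v, hv, Ψ, hΨ, h⟩ := hΦ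
    let R : Θ × ℝ × (Fin n → ℝ) → Matrix (Fin (n + 1)) (Fin (n + 1)) ℝ :=
      fun q => rankOnePart (v q.1) q.2.1 q.2.2
    have hR : Measurable R := (hv.comp measurable_fst).rankOnePart (by fun_prop) (by fun_prop)
    have hN : Measurable fun q : Θ × ℝ × (Fin n → ℝ) => orthoFrame (v q.1) :=
      measurable_orthoFrame.comp (hv.comp measurable_fst)
    have hg : Measurable fun q : Θ × ℝ × (Fin n → ℝ) => (q.1, R q *ᵥ v q.1) :=
      measurable_fst.prodMk (hR.matrix_mulVec (hv.comp measurable_fst))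
    -- The simulated first answer joins the parameter (θ, b, z), and the other k queries are
    -- redirected to the smaller Wishart matrix.
    obtain ⟨h', hm', h1', hsim⟩ := ih ((hΨ.comp_param hg).comp_affine hR hN) (by omega)
    have hmz : Measurable fun q : (Θ × (Fin (k + 1) → ℝ)) × (Fin n → ℝ) =>
        h' (q.1.1, q.1.2 0, q.2) (Fin.tail q.1.2) := by
      have ht : Measurable fun q : (Θ × (Fin (k + 1) → ℝ)) × (Fin n → ℝ) =>
          ((q.1.1, q.1.2 0, q.2), Fin.tail q.1.2) := by
        refine Measurable.prodMk (by fun_prop) (measurable_pi_iff.2 fun i => ?_)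
        simp only [Fin.tail]
        fun_prop
      exact hm'.comp ht
    -- The noise z has a law free of r, so it can be averaged out inside the test function.
    refine ⟨fun θ x => ∫⁻ z, h' (θ, x 0, z) (Fin.tail x) ∂Measure.pi fun _ => gaussianReal 0 1,
      hmz.lintegral_prod_right', fun θ x => ?_, fun θ r hr => ?_⟩
    · calc _ ≤ ∫⁻ z : Fin n → ℝ, 1 ∂Measure.pi fun _ => gaussianReal 0 1 :=
            lintegral_mono fun z => h1' _ _
        _ = 1 := by simp
    obtain ⟨r, rfl⟩ : ∃ s, r = s + 1 := ⟨r - 1, by omega⟩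
    have hpi := (measurePreserving_piFinSuccAbove (fun i : Fin (k + 1) => chiSq (r + 1 - i)) 0).symm
    have hmx : Measurable fun x : Fin (k + 1) → ℝ =>
        ∫⁻ z, h' (θ, x 0, z) (Fin.tail x) ∂Measure.pi fun _ : Fin n => gaussianReal 0 1 :=
      hmz.lintegral_prod_right'.comp measurable_prodMk_left
    have hmy : Measurable fun y : ℝ × (Fin k → ℝ) =>
        ∫⁻ z, h' (θ, (MeasurableEquiv.piFinSuccAbove (fun _ : Fin (k + 1) => ℝ) 0).symm y 0, z)
          (Fin.tail ((MeasurableEquiv.piFinSuccAbove (fun _ : Fin (k + 1) => ℝ) 0).symm y))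
          ∂Measure.pi fun _ : Fin n => gaussianReal 0 1 :=
      hmx.comp (MeasurableEquiv.measurable _)
    rw [lintegral_wishart_succ (v θ) (Φ θ) (hΦm.comp measurable_prodMk_left),
      ← hpi.lintegral_comp hmx,
      lintegral_prod _ hmy.aemeasurable]
    -- The shift r + 1 - (i + 1) = r - i matches the degree of freedom used up by the first query.
    simp only [Fin.zero_succAbove, Fin.val_zero, Nat.sub_zero, Fin.val_succ, Nat.add_sub_add_right]
    refine lintegral_congr fun b => ?_
    have hcons : ∀ x : Fin k → ℝ,
        (MeasurableEquiv.piFinSuccAbove (fun _ : Fin (k + 1) => ℝ) 0).symm (b, x) =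
          Fin.cons b x := fun x => Fin.insertNth_zero (α := fun _ => ℝ) b x
    simp only [hcons, Fin.cons_zero, Fin.tail_cons]
    have hsw : Measurable fun q : (Fin k → ℝ) × (Fin n → ℝ) => h' (θ, b, q.2) q.1 :=
      hm'.comp (by fun_prop : Measurable fun q : (Fin k → ℝ) × (Fin n → ℝ) => ((θ, b, q.2), q.1))
    refine Eq.trans ?_ (lintegral_lintegral_swap hsw.aemeasurable).symm
    refine lintegral_congr fun z => ?_
    rw [← hsim (θ, b, z) r (by omega)]
    refine lintegral_congr fun A => ?_
    have hv0 : (orthoFrame (v θ) * A * (orthoFrame (v θ))ᵀ) *ᵥ v θ = 0 := by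
      rw [← Matrix.mulVec_mulVec, orthoFrame_transpose_mulVec, Matrix.mulVec_zero]
    simp only [h, R, Matrix.add_mulVec, hv0, add_zero]

end IsAdaptive

namespace MatVecAlgorithm

/-- Induction on the number m of queries still to be made, with the seed and the j past answers as
parameter: `answers` grows at its last query, `IsAdaptive` unfolds at its first. -/
lemma exists_isAdaptive {Ω : Type u} [MeasurableSpace Ω] {n k : ℕ} (alg : MatVecAlgorithm Ω n k)
    (m j : ℕ) (hj : j + m = k) :
    ∃ Φ : Ω × (Fin j → Fin n → ℝ) → Matrix (Fin n) (Fin n) ℝ → ENNReal,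
      IsAdaptive m (Ω × (Fin j → Fin n → ℝ)) Φ ∧
        ∀ ω A, Φ (ω, alg.answers A ω j (by omega)) A = if alg.run A ω = true then 1 else 0 := by
  induction m generalizing j with
  | zero =>
    obtain rfl : j = k := by omega
    refine ⟨fun q _ => if alg.output q = true then 1 else 0, ⟨_, ?_, fun q => ?_, fun q A => rfl⟩,
      fun ω A => rfl⟩
    · exact Measurable.ite (alg.measurable_output (measurableSet_singleton true)) measurable_const
        measurable_const
    · split_ifs <;> simp
  | succ m ih =>
    obtain ⟨Ψ, hΨ, h⟩ := ih (j + 1) (by omega)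
    have hg : Measurable fun q : (Ω × (Fin j → Fin n → ℝ)) × (Fin n → ℝ) =>
        (q.1.1, (Fin.snoc (α := fun _ => Fin n → ℝ) q.1.2 q.2 : Fin (j + 1) → Fin n → ℝ)) := by
      refine Measurable.prodMk (by fun_prop) (measurable_pi_iff.2 fun i => ?_)
      refine Fin.lastCases ?_ (fun i => ?_) i
      · simp only [Fin.snoc_last]; fun_prop
      · simp only [Fin.snoc_castSucc]; fun_prop
    refine ⟨_, ⟨alg.query ⟨j, by omega⟩, alg.measurable_query _, _, hΨ.comp_param hg,
      fun q A => rfl⟩, fun ω A => ?_⟩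
    rw [← h ω A]
    rfl

/-- The acceptance probabilities of an algorithm on Wishart matrices with different degrees of
freedom are expectations of one test function of independent chi-squared variables. -/
lemma exists_chiSq_test {Ω : Type u} [MeasurableSpace Ω] {n k : ℕ} (alg : MatVecAlgorithm Ω n k)
    (P : Measure Ω) [IsProbabilityMeasure P] (hkn : k ≤ n) :
    MeasurableSet {p : Matrix (Fin n) (Fin n) ℝ × Ω | alg.run p.1 p.2 = true} ∧
    ∃ H : (Fin k → ℝ) → ENNReal, Measurable H ∧ (∀ x, H x ≤ 1) ∧ ∀ r, k ≤ r →
      ((wishart n r).prod P) {p | alg.run p.1 p.2 = true} =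
        ∫⁻ x, H x ∂Measure.pi fun i : Fin k => chiSq (r - i) := by
  obtain ⟨Ψ, hΨ, h⟩ := alg.exists_isAdaptive k 0 (by omega)
  have hrun : (fun ω A => if alg.run A ω = true then 1 else 0) = fun ω => Ψ (ω, Fin.elim0) :=
    funext fun ω => funext fun A => (h ω A).symm
  have hΦ : IsAdaptive k Ω fun ω A => if alg.run A ω = true then 1 else 0 := by
    rw [hrun]
    exact hΨ.comp_param (by fun_prop)
  have hm := hΦ.measurable
  have hset : MeasurableSet {p : Matrix (Fin n) (Fin n) ℝ × Ω | alg.run p.1 p.2 = true} := by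
    have : {p : Matrix (Fin n) (Fin n) ℝ × Ω | alg.run p.1 p.2 = true} =
        (fun p : Matrix (Fin n) (Fin n) ℝ × Ω =>
          (if alg.run p.1 p.2 = true then 1 else 0 : ENNReal)) ⁻¹' {1} := by
      ext p; by_cases hp : alg.run p.1 p.2 = true <;> simp [hp]
    rw [this]
    exact (hm.comp measurable_swap) (measurableSet_singleton 1)
  refine ⟨hset, ?_⟩
  obtain ⟨t, htm, ht1, ht⟩ := hΦ.exists_simulation hkn
  refine ⟨fun x => ∫⁻ ω, t ω x ∂P, htm.lintegral_prod_left', fun x => ?_, fun r hr => ?_⟩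
  · calc _ ≤ ∫⁻ _, 1 ∂P := lintegral_mono fun ω => ht1 ω x
      _ = 1 := by simp
  · have hsw : Measurable fun q : (Fin k → ℝ) × Ω => t q.2 q.1 := htm.comp measurable_swap
    rw [lintegral_lintegral_swap hsw.aemeasurable, Measure.prod_apply_symm hset]
    refine lintegral_congr fun ω => ?_
    rw [← ht ω r hr, ← lintegral_indicator_one (measurable_prodMk_right hset)]
    refine lintegral_congr fun A => ?_
    by_cases hp : alg.run A ω = true <;> simp [hp, Set.indicator]

end MatVecAlgorithm

/-! ### The likelihood ratio bound and the conclusion. -/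

/-- Each numerator cancels the denominator two places earlier, leaving the first two numerators and
the last two denominators. -/
lemma prod_range_telescope {k r : ℕ} (hkr : k ≤ r) :
    (∏ i ∈ Finset.range k, (((r - i : ℕ) : ℝ) + 2) / ((r - i : ℕ) : ℝ)) *
      (((r : ℝ) - k + 2) * (r - k + 1)) = (r + 2) * (r + 1) := by
  induction k with
  | zero => simp
  | succ k ih =>
    have h := ih (by omega)
    have hlt : (k : ℝ) + 1 ≤ r := by exact_mod_cast hkr
    rw [Finset.prod_range_succ, ← h, Nat.cast_sub (by omega : k ≤ r)]
    push_cast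
    have : (r : ℝ) - k ≠ 0 := by linarith
    field_simp
    ring

/-- A test function of `k` independent chi-squared variables has nearly the same expectation when
all degrees of freedom are raised by two, since the likelihood ratio `L` is a product of normalized
variables whose second moment is a telescoping product. -/
lemma chiSq_test_advantage {k r : ℕ} (hkr : k ≤ r) (H : (Fin k → ℝ) → ENNReal)
    (hH : Measurable H) (hH1 : ∀ x, H x ≤ 1) :
    (∫⁻ x, H x ∂Measure.pi fun i : Fin k => chiSq (r + 2 - i)).toReal -
        (∫⁻ x, H x ∂Measure.pi fun i : Fin k => chiSq (r - i)).toReal ≤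
      (∏ i ∈ Finset.range k, (((r - i : ℕ) : ℝ) + 2) / ((r - i : ℕ) : ℝ)) / 2 - 3 / 8 := by
  set ν : Measure (Fin k → ℝ) := Measure.pi fun i : Fin k => chiSq (r - i)
  let d : Fin k → ℝ → ENNReal := fun i t => ENNReal.ofReal (t / ((r - i : ℕ) : ℝ))
  have hd : ∀ i, Measurable (d i) := fun i => by fun_prop
  have hpos : ∀ i : Fin k, 1 ≤ r - (i : ℕ) := fun i => by omega
  have hchi : ∀ i : Fin k, chiSq (r + 2 - i) = (chiSq (r - i)).withDensity (d i) := fun i => by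
    rw [← chiSq_add_two _ (hpos i)]
    congr 1
    omega
  have hsf : ∀ i : Fin k, SigmaFinite ((chiSq (r - i)).withDensity (d i)) := fun i => by
    rw [← hchi i]; infer_instance
  have hmeas : (Measure.pi fun i : Fin k => chiSq (r + 2 - i)) =
      ν.withDensity fun x => ∏ i, d i (x i) := by
    rw [← pi_withDensity_eq _ d hd]
    exact congrArg Measure.pi (funext hchi)
  let g : (Fin k → ℝ) → ℝ := fun x => (H x).toReal
  have hg : Measurable g := hH.ennreal_toReal
  have hg0 : ∀ x, 0 ≤ g x := fun x => ENNReal.toReal_nonneg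
  have hg1 : ∀ x, g x ≤ 1 := fun x => ENNReal.toReal_le_of_le_ofReal zero_le_one (by simpa using hH1 x)
  -- The likelihood ratio. It agrees with the product of the normalized coordinates only almost
  -- everywhere, where these are nonnegative.
  let L : (Fin k → ℝ) → ℝ := fun x => ∏ i, (d i (x i)).toReal
  have hae : ∀ i : Fin k, (fun t => (d i t).toReal) =ᵐ[chiSq (r - i)]
      fun t => t / ((r - i : ℕ) : ℝ) := fun i => by
    filter_upwards [chiSq_ae_nonneg (r - i)] with t ht
    exact ENNReal.toReal_ofReal (by positivity)
  have hae2 : ∀ i : Fin k, (fun t => (d i t).toReal ^ 2) =ᵐ[chiSq (r - i)]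
      fun t => (t / ((r - i : ℕ) : ℝ)) ^ 2 := fun i => by
    filter_upwards [hae i] with t ht
    rw [ht]
  have hLint : Integrable L ν := Integrable.fintype_prod (f := fun i t => (d i t).toReal) fun i =>
    ((integrable_id_chiSq (r - i)).div_const _).congr (hae i).symm
  have hL2 : ∀ x, L x ^ 2 = ∏ i, (d i (x i)).toReal ^ 2 := fun x => (Finset.prod_pow _ _ _).symm
  have hL2int : Integrable (fun x => L x ^ 2) ν := by
    simp only [hL2]
    exact Integrable.fintype_prod (f := fun i t => (d i t).toReal ^ 2) fun i =>
      (integrable_sq_chiSq _ (hpos i)).congr (hae2 i).symm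
  have hL_one : ∫ x, L x ∂ν = 1 := by
    refine (integral_fintype_prod_eq_prod (fun (i : Fin k) t => (d i t).toReal)).trans ?_
    refine Finset.prod_eq_one fun i _ => ?_
    have : ((r - i : ℕ) : ℝ) ≠ 0 := by have := hpos i; positivity
    rw [integral_congr_ae (hae i), integral_div, integral_id_chiSq, div_self this]
  have hL_sq : ∫ x, L x ^ 2 ∂ν =
      ∏ i ∈ Finset.range k, (((r - i : ℕ) : ℝ) + 2) / ((r - i : ℕ) : ℝ) := by
    simp only [hL2]
    refine (integral_fintype_prod_eq_prod (fun (i : Fin k) t => (d i t).toReal ^ 2)).trans ?_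
    rw [← Fin.prod_univ_eq_prod_range fun i => (((r - i : ℕ) : ℝ) + 2) / ((r - i : ℕ) : ℝ)]
    refine Finset.prod_congr rfl fun i _ => ?_
    rw [integral_congr_ae (hae2 i), integral_sq_chiSq _ (hpos i)]
  have hfin : ∀ x, H x < ⊤ := fun x => (hH1 x).trans_lt ENNReal.one_lt_top
  have e1 : (∫⁻ x, H x ∂ν).toReal = ∫ x, g x ∂ν :=
    (integral_toReal hH.aemeasurable (.of_forall hfin)).symm
  have hdm : Measurable fun x : Fin k → ℝ => ∏ i, d i (x i) :=
    Finset.measurable_prod _ fun i _ => (hd i).comp (measurable_pi_apply i)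
  have e2 : (∫⁻ x, H x ∂Measure.pi fun i : Fin k => chiSq (r + 2 - i)).toReal =
      ∫ x, L x * g x ∂ν := by
    rw [← integral_toReal hH.aemeasurable (.of_forall hfin), hmeas,
      integral_withDensity_eq_integral_toReal_smul hdm
        (.of_forall fun x => ENNReal.prod_lt_top fun i _ => ENNReal.ofReal_lt_top)]
    simp only [ENNReal.toReal_prod, smul_eq_mul, L, g]
  have hgint : Integrable g ν := Integrable.of_bound hg.aestronglyMeasurable 1
    (.of_forall fun x => by rw [Real.norm_of_nonneg (hg0 x)]; exact hg1 x)
  have hLg : Integrable (fun x => L x * g x) ν :=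
    hLint.mul_bdd (c := 1) hg.aestronglyMeasurable
      (.of_forall fun x => by rw [Real.norm_of_nonneg (hg0 x)]; exact hg1 x)
  rw [e1, e2, ← integral_sub hLg hgint]
  have hdiff : Integrable (fun x => L x ^ 2 / 2 - L x / 2) ν :=
    (hL2int.div_const 2).sub (hLint.div_const 2)
  -- Since 0 ≤ g ≤ 1, (L - 1) g is at most the positive part of L - 1, which lies below the parabola
  -- (L - 1/2)² / 2, tangent to it at L = 1/2 and L = 3/2.
  have hbound : ∫ x, (L x * g x - g x) ∂ν ≤ ∫ x, (L x ^ 2 / 2 - L x / 2 + 1 / 8) ∂ν := by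
    refine integral_mono (hLg.sub hgint) (hdiff.add (integrable_const _)) fun x => ?_
    have h0 := hg0 x
    have h1 := hg1 x
    simp only
    rcases le_total (L x) 1 with h | h
    · nlinarith [sq_nonneg (L x - 1 / 2), mul_nonneg h0 (sub_nonneg.2 h)]
    · nlinarith [sq_nonneg (L x - 3 / 2), mul_nonneg (sub_nonneg.2 h1) (sub_nonneg.2 h)]
  refine hbound.trans (le_of_eq ?_)
  rw [integral_add hdiff (integrable_const _),
    integral_sub (hL2int.div_const 2) (hLint.div_const 2), integral_div, integral_div, hL_one, hL_sq]
  simp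
  ring

theorem mainTheorem4 :
    ∃ C₁ C₂ : ℝ, 0 < C₁ ∧ 0 < C₂ ∧
      ∀ (n r k : ℕ), C₁ ≤ (r : ℝ) → C₂ * (r : ℝ) ≤ (n : ℝ) →
        ∀ (Ω : Type*) [MeasurableSpace Ω] (P : Measure Ω) [IsProbabilityMeasure P]
          (alg : MatVecAlgorithm Ω n k),
          2 / 3 ≤ alg.successProb P (wishart n r) (wishart n (r + 2)) →
            (r : ℝ) / 10 ≤ (k : ℝ) := by
  -- Both constants can be 1: all that is needed is k ≤ r and k ≤ n, so that every query has a
  -- degree of freedom and a dimension to use up.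
  refine ⟨1, 1, one_pos, one_pos, fun n r k hr hn Ω _ P _ alg hsucc => ?_⟩
  by_contra! hk
  have hkr : (k : ℝ) ≤ r := by linarith
  have hkn : k ≤ n := by exact_mod_cast (by linarith : (k : ℝ) ≤ n)
  have hkr' : k ≤ r := by exact_mod_cast hkr
  obtain ⟨hset, H, hH, hH1, hsim⟩ := alg.exists_chiSq_test P hkn
  have hadv := chiSq_test_advantage hkr' H hH hH1
  rw [← hsim r hkr', ← hsim (r + 2) (by omega)] at hadv
  have hcompl : ((wishart n r).prod P).real {p | alg.run p.1 p.2 = false} =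
      1 - ((wishart n r).prod P).real {p | alg.run p.1 p.2 = true} := by
    rw [← probReal_compl_eq_one_sub hset]
    congr 1
    ext p
    simp
  rw [MatVecAlgorithm.successProb, hcompl] at hsucc
  simp only [Measure.real] at hsucc
  have htel := prod_range_telescope hkr'
  set c := ∏ i ∈ Finset.range k, (((r - i : ℕ) : ℝ) + 2) / ((r - i : ℕ) : ℝ)
  -- Success 2/3 means an advantage of at least 1/3, and 1/3 ≤ c / 2 - 3/8 gives this bound.
  have hc : 17 / 12 ≤ c := by linarith
  have h2 : (9 / 10 * (r + 2)) * (9 / 10 * (r + 1)) ≤ ((r : ℝ) - k + 2) * (r - k + 1) :=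
    mul_le_mul (by linarith) (by linarith) (by linarith) (by linarith)
  have h3 : (0 : ℝ) < (r + 2) * (r + 1) := by positivity
  -- Contradiction with the telescoped product, because 17/12 · 81/100 > 1.
  nlinarith [mul_le_mul hc h2 (by positivity) (by linarith)]
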